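/- **Theorem (entropy rate formula).** Let $q\ge 2$, $K=\{0,\dots,q-1\}$, and let $E=(E_{ab})_{a,b\in K}$ be a stochastic matrix with $0<E_{ab}<1$ for all $a,b$, with stationary probability vector $\tau$. Let $\epsilon_0=1$ and $0<\epsilon_a<1$ for $a=1,\dots,q-1$. Let $(X_i)_{i\in\mathbb Z}$ be the stationary Markov chain with transition matrix $E$, and let $(Y_i)_{i\in\mathbb Z}$ be the hidden Markov process obtained by observing each $X_i$ independently through the noise $P(Y_i=0\mid X_i=0)=1$, $P(Y_i=0\mid X_i=a)=\epsilon_a$, $P(Y_i=a\mid X_i=a)=1-\epsilon_a$ $(a\neq 0)$. Let $\mu$ be the law of $(Y_i)$ on $K^{\mathbb Z}$ and let $$H(\mu)=\lim_{N\to\infty}\frac{S_N}{N},\qquad S_N=-\sum_{w\in K^N}P(Y_1\cdots Y_N=w)\log_2 P(Y_1\cdots Y_N=w).$$ Let $F_a$ be the matrix whose only non-vanishing row is the $a$-th row of $E$, let $e_a\in\mathbb R^q$ be that row, $E_0=F_0+\sum_{a=1}^{q-1}\epsilon_aF_a$, $E_a=(1-\epsilon_a)F_a$ for $a\ne0$,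 $\sigma=(1,\dots,1)$, $\mathcal W=\{w\in\mathbb R^q: w_a\ge 0,\ \sum_a w_a=1\}$. Put $\Gamma_a w=E_a^{*}w/\langle w,E_a\sigma\rangle$ if $\langle w,E_a\sigma\rangle\neq0$ and $\Gamma_aw=0$ otherwise, $h_a(w)=-\langle w,E_a\sigma\rangle\log_2\langle w,E_a\sigma\rangle$ (with $0\log_20=0$), and $$c_{j,m}=\prod_{i=1}^m\langle\Gamma_0^{m-i}e_j,E_0\sigma\rangle\qquad(1\le j\le q-1,\ m\ge0).$$ Let $A$ be the $q\times(q-1)$ matrix with $$A_{ij}=\begin{cases}-\delta_{ij}+\sum_{m=0}^\infty\langle\Gamma_0^me_j,E_i\sigma\rangle c_{j,m}& q\ne2\\ 0&q=2\end{cases}\quad(1\le i\le q-1),\qquad A_{qj}=\sum_{m=0}^\infty c_{j,m},$$ and $b=(0,\dots,0,1)\in\mathbb R^q$. Then all these series, and the series $\sum_{m=0}^\infty\sum_{a=0}^{q-1} h_a(\Gamma_0^me_j)c_{j,m}$, converge; the system $A\Phi=b$ has exactly one solution $\Phi\in\mathbb R^{q-1}$; the limit $H(\mu)$ exists, and $$H(\mu)=\sum_{j=1}^{q-1}\sum_{m=0}^\infty\sum_{a=0}^{q-1}h_a(\Gamma_0^me_j)\,c_{j,m}\,\Phi_j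 .$$ Moreover there is exactly one probability measure $\phi$ on $\mathcal W$ that is invariant under $T_\mu$, i.e. $\int f\,d\phi=\int T_\mu f\,d\phi$ with $(T_\mu f)(w)=\sum_{a\in K}\langle w,E_a\sigma\rangle f(\Gamma_aw)$, for all continuous $f$ on $\mathcal W\cup\{0\}$ with $f(0)=0$; and $\Phi_j=\phi(\{e_j\})$ for each $j\in\{1,\dots,q-1\}$ such that $e_j\ne\Gamma_0^me_i$ for all $(i,m)\neq(j,0)$ with $1\le i\le q-1$, $m\ge0$. In particular, if the points $\Gamma_0^me_j$ are pairwise distinct, then $\Phi=(\phi(\{e_1\}),\dots,\phi(\{e_{q-1}\}))$. -/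

import Mathlib

open Filter Topology MeasureTheory
open scoped Matrix

noncomputable section

namespace HiddenMarkov

/-! The alphabet is `Fin (n + 1)`, so the number of states is `q = n + 1`; the symbols
`1, ..., q - 1` are the `j.succ` with `j : Fin n`. -/

/-- `Y` is a noisy observation of the stationary Markov chain `X` with transition matrix `E`
(`E b c` is the probability of going from `b` to `c`) and initial distribution `τ`: given `X`, the
`Y i` are independent, and `Y i = a` has probability `R a b` when `X i = b`. -/
structure IsHiddenMarkovProcess {n : ℕ} {Ω : Type*} [MeasurableSpace Ω] (P : Measure Ω)
    (E R : Matrix (Fin (n + 1)) (Fin (n + 1)) ℝ) (τ : Fin (n + 1) → ℝ)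
    (X Y : ℤ → Ω → Fin (n + 1)) : Prop where
  measurable_source : ∀ i, Measurable (X i)
  measurable_obs : ∀ i, Measurable (Y i)
  joint_law : ∀ (s : ℤ) (N : ℕ) (x y : Fin (N + 1) → Fin (n + 1)),
    P.real {ω | ∀ i : Fin (N + 1), X (s + (i : ℕ)) ω = x i ∧ Y (s + (i : ℕ)) ω = y i} =
      τ (x 0) * (∏ i : Fin N, E (x i.castSucc) (x i.succ)) * ∏ i : Fin (N + 1), R (y i) (x i)

/-- `τ` is a stationary probability vector of `E`. -/
def IsStationary {n : ℕ} (E : Matrix (Fin (n + 1)) (Fin (n + 1)) ℝ) (τ : Fin (n + 1) → ℝ) :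
    Prop :=
  τ ∈ stdSimplex ℝ (Fin (n + 1)) ∧ Eᵀ *ᵥ τ = τ

/-- The law on two-sided sequences of the process `Y`. -/
def processLaw {n : ℕ} {Ω : Type*} [MeasurableSpace Ω] (P : Measure Ω)
    (Y : ℤ → Ω → Fin (n + 1)) : Measure (ℤ → Fin (n + 1)) :=
  P.map (fun ω i => Y i ω)

/-- `S_N`, the Shannon entropy (in bits) of the coordinates `1, ..., N` under `μ`. -/
def blockEntropy {n : ℕ} (μ : Measure (ℤ → Fin (n + 1))) (N : ℕ) : ℝ :=
  -∑ w : Fin N → Fin (n + 1),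
    μ.real {ω | ∀ i : Fin N, ω ((i : ℕ) + 1) = w i} *
      Real.logb 2 (μ.real {ω | ∀ i : Fin N, ω ((i : ℕ) + 1) = w i})

/-- The limit defining the entropy rate of `μ` exists and is equal to `H`. -/
def HasEntropyRate {n : ℕ} (μ : Measure (ℤ → Fin (n + 1))) (H : ℝ) : Prop :=
  Tendsto (fun N : ℕ => blockEntropy μ N / N) atTop (𝓝 H)

/-- The noise matrix `R a b = P(Y = a | X = b)`: the symbol `b` is received as `0` with probability
`ε b` and as `b` otherwise. It is used with `ε 0 = 1`. -/
def noise {n : ℕ} (ε : Fin (n + 1) → ℝ) : Matrix (Fin (n + 1)) (Fin (n + 1)) ℝ :=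
  Matrix.of fun a b => if a = 0 then ε b else if a = b then 1 - ε b else 0

/-- `F_b`: the matrix whose only non-vanishing row is the `b`-th row of `E`. -/
def rowMatrix {n : ℕ} (E : Matrix (Fin (n + 1)) (Fin (n + 1)) ℝ) (b : Fin (n + 1)) :
    Matrix (Fin (n + 1)) (Fin (n + 1)) ℝ :=
  Matrix.of fun i j => if i = b then E i j else 0

/-- `E_a = ∑ b, r_{ab} F_b`, for the noise matrix above. -/
def obsMatrix {n : ℕ} (E : Matrix (Fin (n + 1)) (Fin (n + 1)) ℝ) (ε : Fin (n + 1) → ℝ)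
    (a : Fin (n + 1)) : Matrix (Fin (n + 1)) (Fin (n + 1)) ℝ :=
  ∑ b, noise ε a b • rowMatrix E b

/-- `⟨w, E_a σ⟩`, where `σ` is the vector with all components `1`. -/
def weight {n : ℕ} (E : Matrix (Fin (n + 1)) (Fin (n + 1)) ℝ) (ε : Fin (n + 1) → ℝ)
    (a : Fin (n + 1)) (w : Fin (n + 1) → ℝ) : ℝ :=
  w ⬝ᵥ (obsMatrix E ε a *ᵥ fun _ => 1)

/-- `h_a(w) = -⟨w, E_a σ⟩ log₂ ⟨w, E_a σ⟩`. -/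
def h {n : ℕ} (E : Matrix (Fin (n + 1)) (Fin (n + 1)) ℝ) (ε : Fin (n + 1) → ℝ)
    (a : Fin (n + 1)) (w : Fin (n + 1) → ℝ) : ℝ :=
  -(weight E ε a w * Real.logb 2 (weight E ε a w))

open Classical in
/-- `Γ_a`, the normalized action of the transpose of `E_a`. -/
def Gam {n : ℕ} (E : Matrix (Fin (n + 1)) (Fin (n + 1)) ℝ) (ε : Fin (n + 1) → ℝ)
    (a : Fin (n + 1)) (w : Fin (n + 1) → ℝ) : Fin (n + 1) → ℝ :=
  if weight E ε a w ≠ 0 then (weight E ε a w)⁻¹ • ((obsMatrix E ε a)ᵀ *ᵥ w) else 0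

/-- The Markov operator `(T_μ f)(w) = ∑ a, ⟨w, E_a σ⟩ f(Γ_a w)`. -/
def markovOp {n : ℕ} (E : Matrix (Fin (n + 1)) (Fin (n + 1)) ℝ) (ε : Fin (n + 1) → ℝ)
    (f : (Fin (n + 1) → ℝ) → ℝ) (w : Fin (n + 1) → ℝ) : ℝ :=
  ∑ a, weight E ε a w * f (Gam E ε a w)

/-- `φ` is a probability measure on the simplex `W` which is invariant under `T_μ`, tested on
the continuous functions on `W ∪ {0}` that vanish at `0`. -/
structure IsInvariantMeasure {n : ℕ} (E : Matrix (Fin (n + 1)) (Fin (n + 1)) ℝ)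
    (ε : Fin (n + 1) → ℝ) (φ : Measure (Fin (n + 1) → ℝ)) : Prop where
  isProbabilityMeasure : IsProbabilityMeasure φ
  compl_simplex : φ (stdSimplex ℝ (Fin (n + 1)))ᶜ = 0
  invariant : ∀ f : (Fin (n + 1) → ℝ) → ℝ,
    ContinuousOn f (stdSimplex ℝ (Fin (n + 1)) ∪ {0}) → f 0 = 0 →
      ∫ w, f w ∂φ = ∫ w, markovOp E ε f w ∂φ

/-- The point `Γ_0^m e_j`, where `e_j` is the `j`-th row of `E` and `j` is one of the symbols
`1, ..., q - 1`. -/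
def orbitPt {n : ℕ} (E : Matrix (Fin (n + 1)) (Fin (n + 1)) ℝ) (ε : Fin (n + 1) → ℝ)
    (j : Fin n) (m : ℕ) : Fin (n + 1) → ℝ :=
  (Gam E ε 0)^[m] (E j.succ)

/-- `c_{j,m} = ∏_{i=1}^m ⟨Γ_0^{m-i} e_j, E_0 σ⟩`. -/
def c {n : ℕ} (E : Matrix (Fin (n + 1)) (Fin (n + 1)) ℝ) (ε : Fin (n + 1) → ℝ)
    (j : Fin n) (m : ℕ) : ℝ :=
  ∏ i ∈ Finset.Icc 1 m, weight E ε 0 (orbitPt E ε j (m - i))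

/-- The `q × (q - 1)` matrix `A`. Its first `q - 1` rows belong to the symbols `1, ..., q - 1`
(and vanish if `q = 2`), its last row is the normalization. -/
def A {n : ℕ} (E : Matrix (Fin (n + 1)) (Fin (n + 1)) ℝ) (ε : Fin (n + 1) → ℝ) :
    Matrix (Fin (n + 1)) (Fin n) ℝ :=
  Matrix.of fun i j =>
    Fin.lastCases (motive := fun _ => ℝ) (∑' m : ℕ, c E ε j m)
      (fun k : Fin n =>
        if n + 1 = 2 then 0
        else -(if k = j then 1 else 0) +
          ∑' m : ℕ, weight E ε k.succ (orbitPt E ε j m) * c E ε j m) i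

/-- `b = (0, ..., 0, 1)`. -/
def b (n : ℕ) : Fin (n + 1) → ℝ :=
  Pi.single (Fin.last n) 1

end HiddenMarkov

end

/-!
Given the observations up to some time, let the filter state `w` be the conditional law of the
next hidden state. It moves from `w` to `Γ_a w` when the symbol `a` is observed, which has
probability `⟨w, E_a σ⟩`; so `markovOp` is the transition operator of the filter. A symbol `a ≠ 0`
reveals the hidden state and sends the filter to the row `e_a` (`IsErasureChain.gam_succ`);
from then on the filter is a renewal chain living on the points `Γ_0^m e_j`, and `c_{j,m}` is the
probability that an excursion started at `e_j` begins with `m` zeros.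

*Uniqueness and convergence.* Every `Γ_a w` is a convex combination of the rows of `E`, so after
one step a fixed symbol `k ≠ 0` has probability at least some `κ > 0`. This Doeblin condition makes
the operator contract oscillations by `1 - κ` (`IsErasureChain.le_markovOp`). Hence `T_μ^N f w`
tends to `∫ f dφ` for every invariant `φ` and every continuous `f`
(`IsErasureChain.tendsto_iterate`), which forces `φ` to be unique.

*Existence and the linear system.* `A Φ = b` says that `Φ` is fixed by the return matrix of the
nonzero symbols and normalized by the mean excursion lengths (`IsErasureChain.A_mulVec_eq_iff`). The
return matrix is positive with column sums `1`, so there is exactly one such `Φ`, and it is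
nonnegative (`existsUnique_mulVec_eq_self`, `nonneg_of_mulVec_eq`). As the excursion
sums telescope, the measure
`∑ j, ∑ m, Φ_j c_{j,m} δ_{Γ_0^m e_j}` is invariant
(`IsErasureChain.isInvariantMeasure_orbitMeasure`); its masses at the rows are read off directly.

*Entropy.* By the chain rule `S_N = ∑_{k < N} (T_μ^k g)(τ)` with `g = ∑ a, h_a`
(`IsErasureChain.stateEntropy_eq_sum`), so `S_N / N` is a Cesàro mean converging to `∫ g dφ`.
-/

namespace HiddenMarkov

variable {n : ℕ} {E : Matrix (Fin (n + 1)) (Fin (n + 1)) ℝ} {ε : Fin (n + 1) → ℝ}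

/-! ### Transition weights and the maps `Γ_a` -/

/-- The standing assumptions: `E` is a stochastic matrix with positive entries, the symbol `0` is
received without error, and every other symbol is erased with a probability in `(0, 1)`. -/
structure IsErasureChain (E : Matrix (Fin (n + 1)) (Fin (n + 1)) ℝ) (ε : Fin (n + 1) → ℝ) :
    Prop where
  row_sum : ∀ i, ∑ j, E i j = 1
  pos : ∀ i j, 0 < E i j
  eps_zero : ε 0 = 1
  eps_mem : ∀ a, a ≠ 0 → 0 < ε a ∧ ε a < 1

lemma obsMatrix_apply (a i j : Fin (n + 1)) : obsMatrix E ε a i j = noise ε a i * E i j := by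
  simp [obsMatrix, rowMatrix, Matrix.sum_apply]

lemma weight_zero_vec (a : Fin (n + 1)) : weight E ε a 0 = 0 := by simp [weight]

lemma continuous_weight (a : Fin (n + 1)) : Continuous (weight E ε a) :=
  continuous_id.dotProduct continuous_const

lemma transpose_obsMatrix_mulVec (a : Fin (n + 1)) (w : Fin (n + 1) → ℝ) :
    (obsMatrix E ε a)ᵀ *ᵥ w = ∑ i, (w i * noise ε a i) • E i := by
  ext j
  simp only [Matrix.mulVec, dotProduct, Matrix.transpose_apply, obsMatrix_apply, Finset.sum_apply,
    Pi.smul_apply, smul_eq_mul]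
  exact Finset.sum_congr rfl fun i _ => by ring

lemma gam_eq_sum {a : Fin (n + 1)} {w : Fin (n + 1) → ℝ}
    (h : weight E ε a w ≠ 0) :
    Gam E ε a w = ∑ i, (w i * noise ε a i / weight E ε a w) • E i := by
  rw [Gam, if_pos h, transpose_obsMatrix_mulVec, Finset.smul_sum]
  exact Finset.sum_congr rfl fun i _ => by rw [smul_smul]; congr 1; field_simp

namespace IsErasureChain

lemma eps_pos (hE : IsErasureChain E ε) (a : Fin (n + 1)) : 0 < ε a := by
  by_cases ha : a = 0
  · simp [ha, hE.eps_zero]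
  · exact (hE.eps_mem a ha).1

lemma row_mem (hE : IsErasureChain E ε) (i : Fin (n + 1)) : E i ∈ stdSimplex ℝ (Fin (n + 1)) :=
  ⟨fun j => (hE.pos i j).le, hE.row_sum i⟩

lemma weight_eq (hE : IsErasureChain E ε) (a : Fin (n + 1)) (w : Fin (n + 1) → ℝ) :
    weight E ε a w = ∑ i, w i * noise ε a i := by
  simp [weight, dotProduct, Matrix.mulVec, obsMatrix_apply, ← Finset.mul_sum, hE.row_sum]

lemma weight_succ (hE : IsErasureChain E ε) (k : Fin n) (w : Fin (n + 1) → ℝ) :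
    weight E ε k.succ w = w k.succ * (1 - ε k.succ) := by
  simp [hE.weight_eq, noise, Fin.succ_ne_zero]

lemma noise_nonneg (hE : IsErasureChain E ε) (a i : Fin (n + 1)) : 0 ≤ noise ε a i := by
  simp only [noise, Matrix.of_apply]
  split_ifs with h h'
  · exact (hE.eps_pos i).le
  · subst h'
    linarith [(hE.eps_mem a h).2]
  · exact le_rfl

lemma sum_noise (hE : IsErasureChain E ε) (i : Fin (n + 1)) : ∑ a, noise ε a i = 1 := by
  rw [Fin.sum_univ_succ]
  refine Fin.cases ?_ (fun k => ?_) i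
  · simp [noise, Fin.succ_ne_zero, hE.eps_zero]
  · simp [noise, Fin.succ_ne_zero]

lemma weight_nonneg (hE : IsErasureChain E ε) (a : Fin (n + 1)) {w : Fin (n + 1) → ℝ}
    (hw : w ∈ stdSimplex ℝ (Fin (n + 1))) : 0 ≤ weight E ε a w := by
  rw [hE.weight_eq]
  exact Finset.sum_nonneg fun i _ => mul_nonneg (hw.1 i) (hE.noise_nonneg a i)

lemma sum_weight (hE : IsErasureChain E ε) {w : Fin (n + 1) → ℝ}
    (hw : w ∈ stdSimplex ℝ (Fin (n + 1))) : ∑ a, weight E ε a w = 1 := by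
  simp_rw [hE.weight_eq]
  rw [Finset.sum_comm]
  simp [← Finset.mul_sum, hE.sum_noise, hw.2]

lemma weight_le_one (hE : IsErasureChain E ε) (a : Fin (n + 1)) {w : Fin (n + 1) → ℝ}
    (hw : w ∈ stdSimplex ℝ (Fin (n + 1))) : weight E ε a w ≤ 1 := by
  rw [← hE.sum_weight hw]
  exact Finset.single_le_sum (f := fun a => weight E ε a w)
    (fun b _ => hE.weight_nonneg b hw) (Finset.mem_univ a)

lemma weight_zero_pos (hE : IsErasureChain E ε) {w : Fin (n + 1) → ℝ}
    (hw : w ∈ stdSimplex ℝ (Fin (n + 1))) : 0 < weight E ε 0 w := by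
  rw [hE.weight_eq]
  refine Finset.sum_pos' (fun i _ => mul_nonneg (hw.1 i) (hE.noise_nonneg 0 i)) ?_
  obtain ⟨i, -, hi⟩ := Finset.exists_ne_zero_of_sum_ne_zero (s := Finset.univ) (f := w)
    (by rw [hw.2]; exact one_ne_zero)
  refine ⟨i, Finset.mem_univ i, ?_⟩
  simpa [noise] using mul_pos (lt_of_le_of_ne (hw.1 i) hi.symm) (hE.eps_pos i)

/-- After a symbol `k + 1 ≠ 0` the hidden state is known: the filter restarts from a row of
`E`, whatever it was before. -/
lemma gam_succ (hE : IsErasureChain E ε) (k : Fin n) {w : Fin (n + 1) → ℝ}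
    (h : weight E ε k.succ w ≠ 0) : Gam E ε k.succ w = E k.succ := by
  rw [Gam, if_pos h, transpose_obsMatrix_mulVec]
  have : ∀ i, (w i * noise ε k.succ i) • E i =
      if k.succ = i then weight E ε k.succ w • E i else 0 := by
    intro i
    split_ifs with hi
    · subst hi
      simp [hE.weight_succ, noise, Fin.succ_ne_zero]
    · simp [noise, hi, Fin.succ_ne_zero]
  simp_rw [this]
  simp [h]

/-- `Γ_a w` is a convex combination of the rows of `E`. -/
lemma gam_mem (hE : IsErasureChain E ε) {s : Set (Fin (n + 1) → ℝ)} (hs : Convex ℝ s)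
    (hrow : ∀ i, E i ∈ s) {a : Fin (n + 1)} {w : Fin (n + 1) → ℝ}
    (hw : w ∈ stdSimplex ℝ (Fin (n + 1))) (h : weight E ε a w ≠ 0) : Gam E ε a w ∈ s := by
  rw [gam_eq_sum h]
  refine hs.sum_mem (fun i _ => div_nonneg (mul_nonneg (hw.1 i) (hE.noise_nonneg a i))
    (hE.weight_nonneg a hw)) ?_ fun i _ => hrow i
  rw [← Finset.sum_div, ← hE.weight_eq, div_self h]

end IsErasureChain

/-! ### The Markov operator contracts oscillations -/

/-- The points of the simplex at which the symbol `k + 1` has probability at least `κ`. -/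
def core (E : Matrix (Fin (n + 1)) (Fin (n + 1)) ℝ) (ε : Fin (n + 1) → ℝ) (k : Fin n) (κ : ℝ) :
    Set (Fin (n + 1) → ℝ) :=
  {w | w ∈ stdSimplex ℝ (Fin (n + 1)) ∧ κ ≤ weight E ε k.succ w}

lemma convex_core (k : Fin n) (κ : ℝ) : Convex ℝ (core E ε k κ) := by
  refine (convex_stdSimplex ℝ _).inter (convex_halfSpace_ge (f := weight E ε k.succ) ?_ κ)
  exact ⟨fun x y => add_dotProduct _ _ _, fun r x => smul_dotProduct _ _ _⟩

lemma markovOp_neg (f : (Fin (n + 1) → ℝ) → ℝ) (w : Fin (n + 1) → ℝ) :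
    markovOp E ε (fun x => -f x) w = -markovOp E ε f w := by
  simp [markovOp]

namespace IsErasureChain

lemma exists_core (hE : IsErasureChain E ε) (k : Fin n) :
    ∃ κ, 0 < κ ∧ κ ≤ 1 ∧ ∀ i, E i ∈ core E ε k κ := by
  obtain ⟨i, hi⟩ := Finite.exists_min fun i => weight E ε k.succ (E i)
  refine ⟨weight E ε k.succ (E i), ?_, hE.weight_le_one _ (hE.row_mem i),
    fun j => ⟨hE.row_mem j, hi j⟩⟩
  rw [hE.weight_succ]
  exact mul_pos (hE.pos _ _) (by linarith [(hE.eps_mem k.succ (Fin.succ_ne_zero k)).2])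

/-- `T_μ f` only involves the values of `f` on a convex set containing the rows of `E`: where
`Γ_a w` is the junk value `0`, its weight vanishes. -/
lemma weight_mul_comp_gam_le (hE : IsErasureChain E ε) {s : Set (Fin (n + 1) → ℝ)}
    (hs : Convex ℝ s) (hrow : ∀ i, E i ∈ s) {f g : (Fin (n + 1) → ℝ) → ℝ}
    (hfg : ∀ w ∈ s, f w ≤ g w) (a : Fin (n + 1)) {w : Fin (n + 1) → ℝ}
    (hw : w ∈ stdSimplex ℝ (Fin (n + 1))) :
    weight E ε a w * f (Gam E ε a w) ≤ weight E ε a w * g (Gam E ε a w) := by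
  by_cases h : weight E ε a w = 0
  · simp [h]
  · exact mul_le_mul_of_nonneg_left (hfg _ (hE.gam_mem hs hrow hw h)) (hE.weight_nonneg a hw)

lemma markovOp_mono (hE : IsErasureChain E ε) {s : Set (Fin (n + 1) → ℝ)}
    (hs : Convex ℝ s) (hrow : ∀ i, E i ∈ s) {f g : (Fin (n + 1) → ℝ) → ℝ}
    (hfg : ∀ w ∈ s, f w ≤ g w) {w : Fin (n + 1) → ℝ}
    (hw : w ∈ stdSimplex ℝ (Fin (n + 1))) : markovOp E ε f w ≤ markovOp E ε g w :=
  Finset.sum_le_sum fun a _ => hE.weight_mul_comp_gam_le hs hrow hfg a hw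

lemma markovOp_congr (hE : IsErasureChain E ε) {f g : (Fin (n + 1) → ℝ) → ℝ}
    (hfg : ∀ w ∈ stdSimplex ℝ (Fin (n + 1)), f w = g w) {w : Fin (n + 1) → ℝ}
    (hw : w ∈ stdSimplex ℝ (Fin (n + 1))) : markovOp E ε f w = markovOp E ε g w :=
  le_antisymm
    (hE.markovOp_mono (convex_stdSimplex ℝ _) hE.row_mem (fun w hw => (hfg w hw).le) hw)
    (hE.markovOp_mono (convex_stdSimplex ℝ _) hE.row_mem (fun w hw => (hfg w hw).ge) hw)

lemma markovOp_const (hE : IsErasureChain E ε) (C : ℝ) {w : Fin (n + 1) → ℝ}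
    (hw : w ∈ stdSimplex ℝ (Fin (n + 1))) : markovOp E ε (fun _ => C) w = C := by
  simp [markovOp, ← Finset.sum_mul, hE.sum_weight hw]

lemma markovOp_eq (hE : IsErasureChain E ε) (f : (Fin (n + 1) → ℝ) → ℝ) (w : Fin (n + 1) → ℝ) :
    markovOp E ε f w =
      weight E ε 0 w * f (Gam E ε 0 w) + ∑ k : Fin n, weight E ε k.succ w * f (E k.succ) := by
  rw [markovOp, Fin.sum_univ_succ]
  congr 1
  refine Finset.sum_congr rfl fun k _ => ?_
  by_cases h : weight E ε k.succ w = 0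
  · simp [h]
  · rw [hE.gam_succ k h]

/-- The Doeblin minorization: on the core, `T_μ` dominates `κ` times the evaluation at a row. -/
lemma le_markovOp (hE : IsErasureChain E ε) {k : Fin n} {κ : ℝ}
    (hrow : ∀ i, E i ∈ core E ε k κ) {f : (Fin (n + 1) → ℝ) → ℝ} {l : ℝ}
    (hf : ∀ w ∈ core E ε k κ, l ≤ f w) {w : Fin (n + 1) → ℝ} (hw : w ∈ core E ε k κ) :
    κ * f (E k.succ) + (1 - κ) * l ≤ markovOp E ε f w := by
  have h0 : weight E ε 0 w * l ≤ weight E ε 0 w * f (Gam E ε 0 w) :=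
    hE.weight_mul_comp_gam_le (f := fun _ => l) (convex_core k κ) hrow hf 0 hw.1
  have h1 : ∀ i : Fin n, weight E ε i.succ w * l + (if i = k then κ * (f (E k.succ) - l) else 0) ≤
      weight E ε i.succ w * f (E i.succ) := by
    intro i
    have hl := hf _ (hrow i.succ)
    split_ifs with hi
    · subst hi
      nlinarith [hw.2]
    · simpa using mul_le_mul_of_nonneg_left hl (hE.weight_nonneg i.succ hw.1)
  have h2 := Finset.sum_le_sum fun i (_ : i ∈ Finset.univ) => h1 i
  have h3 := hE.sum_weight hw.1
  rw [Finset.sum_add_distrib, ← Finset.sum_mul] at h2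
  rw [Fin.sum_univ_succ] at h3
  simp only [Finset.sum_ite_eq', Finset.mem_univ, if_true] at h2
  rw [hE.markovOp_eq]
  have h4 : (weight E ε 0 w + ∑ i : Fin n, weight E ε i.succ w) * l = l := by rw [h3, one_mul]
  linarith

/-- On the core, each application of `T_μ` shrinks the range of a function by `1 - κ`. -/
lemma exists_bounds_iterate (hE : IsErasureChain E ε) {k : Fin n} {κ : ℝ}
    (hrow : ∀ i, E i ∈ core E ε k κ) {f : (Fin (n + 1) → ℝ) → ℝ} {l u : ℝ}
    (hf : ∀ w ∈ core E ε k κ, f w ∈ Set.Icc l u) (N : ℕ) :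
    ∃ l' u', u' - l' = (1 - κ) ^ N * (u - l) ∧
      ∀ w ∈ core E ε k κ, (markovOp E ε)^[N] f w ∈ Set.Icc l' u' := by
  induction N with
  | zero => exact ⟨l, u, by simp, hf⟩
  | succ N ih =>
    obtain ⟨l', u', h, hb⟩ := ih
    set g := (markovOp E ε)^[N] f with hg
    refine ⟨κ * g (E k.succ) + (1 - κ) * l', κ * g (E k.succ) + (1 - κ) * u',
      by rw [pow_succ']; linear_combination (1 - κ) * h, fun w hw => ?_⟩
    rw [Function.iterate_succ_apply', ← hg]
    refine ⟨hE.le_markovOp hrow (fun x hx => (hb x hx).1) hw, ?_⟩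
    have := hE.le_markovOp hrow (f := fun x => -g x) (l := -u')
      (fun x hx => neg_le_neg (hb x hx).2) hw
    rw [markovOp_neg] at this
    linarith

/-- One more step makes the bounds on the core valid on the whole simplex, since `Γ_a` maps the
simplex into the core. -/
lemma exists_bounds_iterate_succ (hE : IsErasureChain E ε) {k : Fin n} {κ : ℝ}
    (hrow : ∀ i, E i ∈ core E ε k κ) {f : (Fin (n + 1) → ℝ) → ℝ} {l u : ℝ}
    (hf : ∀ w ∈ core E ε k κ, f w ∈ Set.Icc l u) (N : ℕ) :
    ∃ l' u', u' - l' = (1 - κ) ^ N * (u - l) ∧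
      ∀ w ∈ stdSimplex ℝ (Fin (n + 1)), (markovOp E ε)^[N + 1] f w ∈ Set.Icc l' u' := by
  obtain ⟨l', u', h, hb⟩ := hE.exists_bounds_iterate hrow hf N
  refine ⟨l', u', h, fun w hw => ?_⟩
  rw [Function.iterate_succ_apply']
  constructor
  · rw [← hE.markovOp_const l' hw]
    exact hE.markovOp_mono (convex_core k κ) hrow (fun x hx => (hb x hx).1) hw
  · conv_rhs => rw [← hE.markovOp_const u' hw]
    exact hE.markovOp_mono (convex_core k κ) hrow (fun x hx => (hb x hx).2) hw

end IsErasureChain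

/-! ### Convergence to an invariant measure -/

lemma markovOp_zero_vec (f : (Fin (n + 1) → ℝ) → ℝ) : markovOp E ε f 0 = 0 := by
  simp [markovOp, weight_zero_vec]

/-- The point `0` is isolated in `W ∪ {0}`, so continuity there is no condition. -/
lemma continuousOn_union_zero {f : (Fin (n + 1) → ℝ) → ℝ}
    (hf : ContinuousOn f (stdSimplex ℝ (Fin (n + 1)))) :
    ContinuousOn f (stdSimplex ℝ (Fin (n + 1)) ∪ {0}) :=
  hf.union_of_isClosed (continuousOn_singleton f 0) (isClosed_stdSimplex _ _) isClosed_singleton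

namespace IsErasureChain

lemma continuousOn_gam_zero (hE : IsErasureChain E ε) :
    ContinuousOn (Gam E ε 0) (stdSimplex ℝ (Fin (n + 1))) := by
  have : ContinuousOn (fun w => (weight E ε 0 w)⁻¹ • ((obsMatrix E ε 0)ᵀ *ᵥ w))
      (stdSimplex ℝ (Fin (n + 1))) :=
    ((continuous_weight 0).continuousOn.inv₀ fun w hw => (hE.weight_zero_pos hw).ne').smul
      (continuous_const.matrix_mulVec continuous_id).continuousOn
  exact this.congr fun w hw => by rw [Gam, if_pos (hE.weight_zero_pos hw).ne']

lemma continuousOn_markovOp (hE : IsErasureChain E ε) {f : (Fin (n + 1) → ℝ) → ℝ}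
    (hf : ContinuousOn f (stdSimplex ℝ (Fin (n + 1)))) :
    ContinuousOn (markovOp E ε f) (stdSimplex ℝ (Fin (n + 1))) := by
  rw [funext (hE.markovOp_eq f)]
  refine ((continuous_weight 0).continuousOn.mul (hf.comp hE.continuousOn_gam_zero fun w hw =>
    hE.gam_mem (convex_stdSimplex ℝ _) hE.row_mem hw (hE.weight_zero_pos hw).ne')).add ?_
  exact (continuous_finsetSum _ fun k _ =>
    (continuous_weight k.succ).mul continuous_const).continuousOn

lemma continuousOn_iterate (hE : IsErasureChain E ε) {f : (Fin (n + 1) → ℝ) → ℝ}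
    (hf : ContinuousOn f (stdSimplex ℝ (Fin (n + 1)))) (N : ℕ) :
    ContinuousOn ((markovOp E ε)^[N] f) (stdSimplex ℝ (Fin (n + 1))) := by
  induction N with
  | zero => exact hf
  | succ N ih =>
    rw [Function.iterate_succ_apply']
    exact hE.continuousOn_markovOp ih

lemma integral_iterate (hE : IsErasureChain E ε) {φ : Measure (Fin (n + 1) → ℝ)}
    (hφ : IsInvariantMeasure E ε φ) {f : (Fin (n + 1) → ℝ) → ℝ}
    (hf : ContinuousOn f (stdSimplex ℝ (Fin (n + 1)))) (hf0 : f 0 = 0) (N : ℕ) :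
    ∫ w, (markovOp E ε)^[N] f w ∂φ = ∫ w, f w ∂φ := by
  induction N with
  | zero => rfl
  | succ N ih =>
    rw [← ih]
    simp_rw [Function.iterate_succ_apply']
    refine (hφ.invariant _ (continuousOn_union_zero (hE.continuousOn_iterate hf N)) ?_).symm
    cases N with
    | zero => exact hf0
    | succ N => rw [Function.iterate_succ_apply', markovOp_zero_vec]

/-- Both `T_μ^N f w` and `∫ f dφ = ∫ T_μ^N f dφ` lie in the shrinking range of `T_μ^N f`. -/
lemma tendsto_iterate (hE : IsErasureChain E ε) (hn : 0 < n) {φ : Measure (Fin (n + 1) → ℝ)}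
    (hφ : IsInvariantMeasure E ε φ) {f : (Fin (n + 1) → ℝ) → ℝ}
    (hf : ContinuousOn f (stdSimplex ℝ (Fin (n + 1)))) (hf0 : f 0 = 0)
    {w : Fin (n + 1) → ℝ} (hw : w ∈ stdSimplex ℝ (Fin (n + 1))) :
    Tendsto (fun N => (markovOp E ε)^[N] f w) atTop (𝓝 (∫ w, f w ∂φ)) := by
  have := hφ.isProbabilityMeasure
  have hae : ∀ᵐ x ∂φ, x ∈ stdSimplex ℝ (Fin (n + 1)) := hφ.compl_simplex
  obtain ⟨κ, hκ, hκ1, hrow⟩ := hE.exists_core ⟨0, hn⟩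
  obtain ⟨C, hC⟩ := (isCompact_stdSimplex ℝ (Fin (n + 1))).exists_bound_of_continuousOn hf
  have hint : ∀ N, Integrable ((markovOp E ε)^[N] f) φ := by
    intro N
    have h := (hE.continuousOn_iterate hf N).integrableOn_compact (μ := φ)
      (isCompact_stdSimplex ℝ (Fin (n + 1)))
    rwa [IntegrableOn, Measure.restrict_eq_self_of_ae_mem hae] at h
  rw [← tendsto_add_atTop_iff_nat 1, tendsto_iff_dist_tendsto_zero]
  have hlim : Tendsto (fun N : ℕ => (1 - κ) ^ N * (C - -C)) atTop (𝓝 0) := by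
    simpa using (tendsto_pow_atTop_nhds_zero_of_lt_one (by linarith : 0 ≤ 1 - κ)
      (by linarith)).mul_const (C - -C)
  refine squeeze_zero (fun _ => dist_nonneg) (fun N => ?_) hlim
  obtain ⟨l, u, hlu, hb⟩ := hE.exists_bounds_iterate_succ hrow (f := f) (l := -C) (u := C)
    (fun x hx => abs_le.1 (hC x hx.1)) N
  have h1 := integral_mono_ae (μ := φ) (integrable_const l) (hint (N + 1))
    (hae.mono fun x hx => (hb x hx).1)
  have h2 := integral_mono_ae (μ := φ) (hint (N + 1)) (integrable_const u)
    (hae.mono fun x hx => (hb x hx).2)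
  rw [hE.integral_iterate hφ hf hf0] at h1 h2
  simp only [integral_const, probReal_univ, one_smul] at h1 h2
  rw [← hlu]
  exact Real.dist_le_of_mem_Icc (hb w hw) ⟨h1, h2⟩

lemma invariantMeasure_unique (hE : IsErasureChain E ε) (hn : 0 < n)
    {φ ψ : Measure (Fin (n + 1) → ℝ)}
    (hφ : IsInvariantMeasure E ε φ) (hψ : IsInvariantMeasure E ε ψ) : φ = ψ := by
  have := hφ.isProbabilityMeasure
  have := hψ.isProbabilityMeasure
  refine ext_of_forall_integral_eq_of_IsFiniteMeasure fun f => ?_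
  -- `f` need not vanish at `0`, but it has the same integral as `w ↦ (∑ i, w i) * f w`
  have key : ∀ χ : Measure (Fin (n + 1) → ℝ), IsInvariantMeasure E ε χ →
      ∫ w, f w ∂χ = ∫ w, (∑ i, w i) * f w ∂χ := fun χ hχ => by
    have hae : ∀ᵐ x ∂χ, x ∈ stdSimplex ℝ (Fin (n + 1)) := hχ.compl_simplex
    exact integral_congr_ae (hae.mono fun x hx => by simp [hx.2])
  have hc : ContinuousOn (fun w => (∑ i, w i) * f w) (stdSimplex ℝ (Fin (n + 1))) :=
    ((continuous_finsetSum _ fun i _ => continuous_apply i).mul f.continuous).continuousOn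
  rw [key φ hφ, key ψ hψ]
  exact tendsto_nhds_unique (hE.tendsto_iterate hn hφ hc (by simp) (hE.row_mem 0))
    (hE.tendsto_iterate hn hψ hc (by simp) (hE.row_mem 0))

end IsErasureChain

/-! ### Positive column-stochastic matrices -/

section Perron

variable {ι : Type*} [Fintype ι] {M : Matrix ι ι ℝ}

/-- A fixed vector has constant sign: otherwise `∑ i, |v i|` would strictly decrease. -/
lemma nonneg_or_nonpos_of_mulVec_eq (hpos : ∀ i j, 0 < M i j) (hsum : ∀ j, ∑ i, M i j = 1)
    {v : ι → ℝ} (hv : M *ᵥ v = v) : (∀ i, 0 ≤ v i) ∨ ∀ i, v i ≤ 0 := by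
  rcases isEmpty_or_nonempty ι with h | ⟨⟨i⟩⟩
  · exact Or.inl fun i => (h.false i).elim
  have hv' : ∀ i, ∑ j, M i j * v j = v i := fun i => congrFun hv i
  have hle : ∀ i ∈ Finset.univ, |v i| ≤ ∑ j, M i j * |v j| := fun i _ => by
    conv_lhs => rw [← hv' i]
    refine (Finset.abs_sum_le_sum_abs _ _).trans_eq (Finset.sum_congr rfl fun j _ => ?_)
    rw [abs_mul, abs_of_pos (hpos i j)]
  have htot : ∑ i, |v i| = ∑ i, ∑ j, M i j * |v j| := by
    rw [Finset.sum_comm]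
    simp [← Finset.sum_mul, hsum]
  have heq := (Finset.sum_eq_sum_iff_of_le hle).1 htot i (Finset.mem_univ i)
  rcases abs_cases (v i) with ⟨h, -⟩ | ⟨h, -⟩
  · left
    have h0 : ∑ j, M i j * (|v j| - v j) = 0 := by
      simp_rw [mul_sub, Finset.sum_sub_distrib, hv' i, ← heq, h, sub_self]
    intro j
    have := (Finset.sum_eq_zero_iff_of_nonneg fun j _ =>
      mul_nonneg (hpos i j).le (sub_nonneg.2 (le_abs_self (v j)))).1 h0 j (Finset.mem_univ j)
    rw [mul_eq_zero, or_iff_right (hpos i j).ne', sub_eq_zero] at this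
    exact abs_eq_self.1 this
  · right
    have h0 : ∑ j, M i j * (|v j| + v j) = 0 := by
      simp_rw [mul_add, Finset.sum_add_distrib, hv' i, ← heq, h, neg_add_cancel]
    intro j
    have := (Finset.sum_eq_zero_iff_of_nonneg fun j _ =>
      mul_nonneg (hpos i j).le (by linarith [neg_le_abs (v j)])).1 h0 j (Finset.mem_univ j)
    rw [mul_eq_zero, or_iff_right (hpos i j).ne'] at this
    exact abs_eq_neg_self.1 (by linarith)

/-- Column sums `1` make the row vector `1` a left null vector of `M - 1`, which is therefore
singular. -/
lemma exists_mulVec_eq_self [Nonempty ι] (hsum : ∀ j, ∑ i, M i j = 1) :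
    ∃ v ≠ 0, M *ᵥ v = v := by
  classical
  have hdet : (M - 1).det = 0 := by
    rw [← Matrix.exists_vecMul_eq_zero_iff]
    refine ⟨1, one_ne_zero, ?_⟩
    rw [Matrix.vecMul_sub, Matrix.vecMul_one, sub_eq_zero]
    ext j
    simp [Matrix.vecMul, dotProduct, hsum]
  obtain ⟨v, hv, h⟩ := Matrix.exists_mulVec_eq_zero_iff.2 hdet
  rw [Matrix.sub_mulVec, Matrix.one_mulVec, sub_eq_zero] at h
  exact ⟨v, hv, h⟩

lemma eq_zero_of_mulVec_eq (hpos : ∀ i j, 0 < M i j) (hsum : ∀ j, ∑ i, M i j = 1)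
    {d : ι → ℝ} (hd : ∀ i, 0 < d i) {v : ι → ℝ} (hv : M *ᵥ v = v) (h : ∑ i, d i * v i = 0) :
    v = 0 := by
  ext i
  rcases nonneg_or_nonpos_of_mulVec_eq hpos hsum hv with hs | hs
  · have := (Finset.sum_eq_zero_iff_of_nonneg fun j _ => mul_nonneg (hd j).le (hs j)).1 h i
      (Finset.mem_univ i)
    exact (mul_eq_zero.1 this).resolve_left (hd i).ne'
  · have := (Finset.sum_eq_zero_iff_of_nonpos fun j _ =>
      mul_nonpos_of_nonneg_of_nonpos (hd j).le (hs j)).1 h i (Finset.mem_univ i)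
    exact (mul_eq_zero.1 this).resolve_left (hd i).ne'

/-- The Perron vector, normalized by positive weights `d`. -/
lemma existsUnique_mulVec_eq_self [Nonempty ι] (hpos : ∀ i j, 0 < M i j)
    (hsum : ∀ j, ∑ i, M i j = 1) {d : ι → ℝ} (hd : ∀ i, 0 < d i) :
    ∃! v : ι → ℝ, M *ᵥ v = v ∧ ∑ i, d i * v i = 1 := by
  obtain ⟨v, hv0, hv⟩ := exists_mulVec_eq_self hsum
  have hne : ∑ i, d i * v i ≠ 0 := fun h => hv0 (eq_zero_of_mulVec_eq hpos hsum hd hv h)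
  refine ⟨(∑ i, d i * v i)⁻¹ • v, ⟨by rw [Matrix.mulVec_smul, hv], ?_⟩, fun u hu => ?_⟩
  · simp_rw [Pi.smul_apply, smul_eq_mul, mul_left_comm (d _), ← Finset.mul_sum]
    exact inv_mul_cancel₀ hne
  · rw [← sub_eq_zero]
    refine eq_zero_of_mulVec_eq hpos hsum hd
      (by rw [Matrix.mulVec_sub, hu.1, Matrix.mulVec_smul, hv]) ?_
    simp_rw [Pi.sub_apply, mul_sub, Finset.sum_sub_distrib, hu.2, Pi.smul_apply, smul_eq_mul,
      mul_left_comm (d _), ← Finset.mul_sum, inv_mul_cancel₀ hne, sub_self]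

lemma nonneg_of_mulVec_eq (hpos : ∀ i j, 0 < M i j) (hsum : ∀ j, ∑ i, M i j = 1)
    {d : ι → ℝ} (hd : ∀ i, 0 < d i) {v : ι → ℝ} (hv : M *ᵥ v = v) (h : ∑ i, d i * v i = 1)
    (i : ι) : 0 ≤ v i := by
  rcases nonneg_or_nonpos_of_mulVec_eq hpos hsum hv with hs | hs
  · exact hs i
  · have := Finset.sum_nonpos fun j (_ : j ∈ Finset.univ) =>
      mul_nonpos_of_nonneg_of_nonpos (hd j).le (hs j)
    linarith

end Perron

/-! ### Excursions between nonzero symbols -/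

@[simp] lemma orbitPt_zero (j : Fin n) : orbitPt E ε j 0 = E j.succ := rfl

lemma orbitPt_succ (j : Fin n) (m : ℕ) : orbitPt E ε j (m + 1) = Gam E ε 0 (orbitPt E ε j m) :=
  Function.iterate_succ_apply' _ _ _

lemma c_eq_prod_range (j : Fin n) (m : ℕ) :
    c E ε j m = ∏ i ∈ Finset.range m, weight E ε 0 (orbitPt E ε j i) := by
  refine Finset.prod_nbij' (fun i => m - i) (fun i => m - i) ?_ ?_ ?_ ?_ fun _ _ => rfl <;>
    intro i hi <;> simp only [Finset.mem_Icc, Finset.mem_range] at hi ⊢ <;> omega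

@[simp] lemma c_zero (j : Fin n) : c E ε j 0 = 1 := by simp [c]

lemma c_succ (j : Fin n) (m : ℕ) :
    c E ε j (m + 1) = c E ε j m * weight E ε 0 (orbitPt E ε j m) := by
  rw [c_eq_prod_range, c_eq_prod_range, Finset.prod_range_succ]

/-- The transition matrix of the nonzero symbols, with the zeros in between deleted: the `(k, j)`
entry is the probability that the next nonzero symbol is `k + 1` when the last one was `j + 1`. -/
noncomputable def returnMatrix (E : Matrix (Fin (n + 1)) (Fin (n + 1)) ℝ) (ε : Fin (n + 1) → ℝ) :
    Matrix (Fin n) (Fin n) ℝ :=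
  Matrix.of fun k j => ∑' m : ℕ, weight E ε k.succ (orbitPt E ε j m) * c E ε j m

namespace IsErasureChain

lemma orbitPt_mem (hE : IsErasureChain E ε) {s : Set (Fin (n + 1) → ℝ)} (hs : Convex ℝ s)
    (hss : s ⊆ stdSimplex ℝ (Fin (n + 1))) (hrow : ∀ i, E i ∈ s) (j : Fin n) (m : ℕ) :
    orbitPt E ε j m ∈ s := by
  induction m with
  | zero => exact hrow _
  | succ m ih =>
    rw [orbitPt_succ]
    exact hE.gam_mem hs hrow (hss ih) (hE.weight_zero_pos (hss ih)).ne'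

lemma orbitPt_mem_stdSimplex (hE : IsErasureChain E ε) (j : Fin n) (m : ℕ) :
    orbitPt E ε j m ∈ stdSimplex ℝ (Fin (n + 1)) :=
  hE.orbitPt_mem (convex_stdSimplex ℝ _) subset_rfl hE.row_mem j m

lemma c_nonneg (hE : IsErasureChain E ε) (j : Fin n) (m : ℕ) : 0 ≤ c E ε j m := by
  rw [c_eq_prod_range]
  exact Finset.prod_nonneg fun i _ => hE.weight_nonneg 0 (hE.orbitPt_mem_stdSimplex j i)

/-- On the core the symbol `0` has probability at most `1 - κ`, so `c_{j,m}` decays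
geometrically. -/
lemma summable_c (hE : IsErasureChain E ε) (j : Fin n) : Summable (c E ε j) := by
  obtain ⟨κ, hκ, hκ1, hrow⟩ := hE.exists_core j
  refine Summable.of_nonneg_of_le (hE.c_nonneg j) (fun m => ?_)
    (summable_geometric_of_lt_one (r := 1 - κ) (by linarith) (by linarith))
  rw [c_eq_prod_range, ← Finset.card_range m, ← Finset.prod_const, Finset.card_range]
  refine Finset.prod_le_prod (fun i _ => hE.weight_nonneg 0 (hE.orbitPt_mem_stdSimplex j i))
    fun i _ => ?_
  have hmem := hE.orbitPt_mem (convex_core j κ) (fun w hw => hw.1) hrow j i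
  have hsum := hE.sum_weight hmem.1
  rw [Fin.sum_univ_succ] at hsum
  have := Finset.single_le_sum (f := fun k : Fin n => weight E ε k.succ (orbitPt E ε j i))
    (fun k _ => hE.weight_nonneg k.succ hmem.1) (Finset.mem_univ j)
  linarith [hmem.2]

lemma summable_c_mul (hE : IsErasureChain E ε) {f : (Fin (n + 1) → ℝ) → ℝ} {C : ℝ}
    (hf : ∀ w ∈ stdSimplex ℝ (Fin (n + 1)), |f w| ≤ C) (j : Fin n) :
    Summable fun m => c E ε j m * f (orbitPt E ε j m) := by
  refine Summable.of_norm_bounded ((hE.summable_c j).mul_right C) fun m => ?_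
  rw [norm_mul, Real.norm_of_nonneg (hE.c_nonneg j m)]
  exact mul_le_mul_of_nonneg_left (hf _ (hE.orbitPt_mem_stdSimplex j m)) (hE.c_nonneg j m)

lemma summable_weight_mul_c (hE : IsErasureChain E ε) (a : Fin (n + 1)) (j : Fin n) :
    Summable fun m => weight E ε a (orbitPt E ε j m) * c E ε j m := by
  simp_rw [mul_comm (weight _ _ _ _)]
  refine hE.summable_c_mul (f := weight E ε a) (C := 1) (fun w hw => ?_) j
  rw [abs_of_nonneg (hE.weight_nonneg a hw)]
  exact hE.weight_le_one a hw

lemma tsum_c_pos (hE : IsErasureChain E ε) (j : Fin n) : 0 < ∑' m, c E ε j m :=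
  (hE.summable_c j).tsum_pos (hE.c_nonneg j) 0 (by simp)

lemma returnMatrix_pos (hE : IsErasureChain E ε) (k j : Fin n) : 0 < returnMatrix E ε k j := by
  refine (hE.summable_weight_mul_c k.succ j).tsum_pos
    (fun m => mul_nonneg (hE.weight_nonneg _ (hE.orbitPt_mem_stdSimplex j m)) (hE.c_nonneg j m))
    0 ?_
  rw [c_zero, mul_one, hE.weight_succ]
  exact mul_pos (hE.pos _ _) (by linarith [(hE.eps_mem k.succ (Fin.succ_ne_zero k)).2])

/-- The `j`-th column sum telescopes, since `∑ k ≠ 0, ⟨w, E_k σ⟩ = 1 - ⟨w, E_0 σ⟩`. -/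
lemma sum_returnMatrix (hE : IsErasureChain E ε) (j : Fin n) : ∑ k, returnMatrix E ε k j = 1 := by
  simp only [returnMatrix, Matrix.of_apply]
  have hs := fun k : Fin n => hE.summable_weight_mul_c k.succ j
  rw [← Summable.tsum_finsetSum fun k _ => hs k]
  have h : ∀ m, ∑ k : Fin n, weight E ε k.succ (orbitPt E ε j m) * c E ε j m =
      c E ε j m - c E ε j (m + 1) := fun m => by
    have hsum := hE.sum_weight (hE.orbitPt_mem_stdSimplex j m)
    rw [Fin.sum_univ_succ] at hsum
    rw [← Finset.sum_mul, c_succ]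
    linear_combination c E ε j m * hsum
  simp_rw [h]
  rw [(hE.summable_c j).tsum_sub ((summable_nat_add_iff 1).2 (hE.summable_c j)),
    (hE.summable_c j).tsum_eq_zero_add, c_zero]
  ring

/-- The linear system `A Φ = b` says that `Φ` is fixed by the return matrix and normalized by the
mean excursion lengths. For `n = 1` the return matrix is `1`, in accordance with the zero row
of `A`. -/
lemma A_mulVec_eq_iff (hE : IsErasureChain E ε) (Φ : Fin n → ℝ) :
    A E ε *ᵥ Φ = b n ↔ returnMatrix E ε *ᵥ Φ = Φ ∧ ∑ j, (∑' m, c E ε j m) * Φ j = 1 := by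
  have hA : ∀ k j, A E ε (Fin.castSucc k) j = returnMatrix E ε k j - if k = j then 1 else 0 := by
    intro k j
    simp only [A, Matrix.of_apply, Fin.lastCases_castSucc]
    split_ifs with h1 h2 h2
    · obtain rfl : n = 1 := by omega
      have := hE.sum_returnMatrix j
      rw [Fin.sum_univ_one, Subsingleton.elim 0 k] at this
      rw [this, sub_self]
    · obtain rfl : n = 1 := by omega
      exact absurd (Subsingleton.elim k j) h2
    · simp only [returnMatrix, Matrix.of_apply]; ring
    · simp only [returnMatrix, Matrix.of_apply]; ring
  have hlast : ∀ j, A E ε (Fin.last n) j = ∑' m, c E ε j m := fun j => by simp [A]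
  constructor
  · intro h
    refine ⟨funext fun k => ?_, ?_⟩
    · have := congrFun h k.castSucc
      simp only [Matrix.mulVec, dotProduct, hA, b, Pi.single_apply, (Fin.castSucc_lt_last k).ne,
        if_false, sub_mul, Finset.sum_sub_distrib, ite_mul, one_mul, zero_mul,
        Finset.sum_ite_eq, Finset.mem_univ, if_true] at this
      exact sub_eq_zero.1 this
    · have := congrFun h (Fin.last n)
      simpa [Matrix.mulVec, dotProduct, hlast, b] using this
  · rintro ⟨h1, h2⟩
    ext i
    refine Fin.lastCases ?_ (fun k => ?_) i
    · simpa [Matrix.mulVec, dotProduct, hlast, b] using h2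
    · have := congrFun h1 k
      simp only [Matrix.mulVec, dotProduct] at this
      simp [Matrix.mulVec, dotProduct, hA, b, (Fin.castSucc_lt_last k).ne,
        sub_mul, Finset.sum_sub_distrib, this]

lemma existsUnique_A_mulVec (hE : IsErasureChain E ε) (hn : 0 < n) :
    ∃! Φ : Fin n → ℝ, A E ε *ᵥ Φ = b n := by
  have : Nonempty (Fin n) := ⟨⟨0, hn⟩⟩
  simp_rw [hE.A_mulVec_eq_iff]
  exact existsUnique_mulVec_eq_self hE.returnMatrix_pos hE.sum_returnMatrix hE.tsum_c_pos

end IsErasureChain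

/-! ### The invariant measure -/

/-- The measure `∑ j, ∑ m, Φ_j c_{j,m} δ_{Γ_0^m e_j}`. -/
noncomputable def orbitMeasure (E : Matrix (Fin (n + 1)) (Fin (n + 1)) ℝ) (ε : Fin (n + 1) → ℝ)
    (Φ : Fin n → ℝ) : Measure (Fin (n + 1) → ℝ) :=
  Measure.sum fun p : Fin n × ℕ =>
    ENNReal.ofReal (c E ε p.1 p.2 * Φ p.1) • Measure.dirac (orbitPt E ε p.1 p.2)

namespace IsErasureChain

lemma nonneg_of_A_mulVec (hE : IsErasureChain E ε) {Φ : Fin n → ℝ} (hΦ : A E ε *ᵥ Φ = b n)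
    (j : Fin n) : 0 ≤ Φ j := by
  obtain ⟨h1, h2⟩ := (hE.A_mulVec_eq_iff Φ).1 hΦ
  exact nonneg_of_mulVec_eq hE.returnMatrix_pos hE.sum_returnMatrix hE.tsum_c_pos h1 h2 j

lemma integral_orbitMeasure (hE : IsErasureChain E ε) {Φ : Fin n → ℝ} (hΦ : ∀ j, 0 ≤ Φ j)
    {f : (Fin (n + 1) → ℝ) → ℝ} {C : ℝ} (hf : ∀ w ∈ stdSimplex ℝ (Fin (n + 1)), |f w| ≤ C) :
    ∫ w, f w ∂orbitMeasure E ε Φ = ∑ j, (∑' m, c E ε j m * f (orbitPt E ε j m)) * Φ j := by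
  have hsum : Summable fun p : Fin n × ℕ => c E ε p.1 p.2 * Φ p.1 * f (orbitPt E ε p.1 p.2) := by
    have h0 : Summable fun p : Fin n × ℕ => c E ε p.1 p.2 * Φ p.1 * C := by
      refine Summable.mul_right C ((summable_prod_of_nonneg fun p =>
        mul_nonneg (hE.c_nonneg p.1 p.2) (hΦ p.1)).2
        ⟨fun j => (hE.summable_c j).mul_right (Φ j), ?_⟩)
      exact (hasSum_fintype _).summable
    refine Summable.of_norm_bounded h0 fun p => ?_
    have hp := mul_nonneg (hE.c_nonneg p.1 p.2) (hΦ p.1)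
    rw [norm_mul, Real.norm_of_nonneg hp]
    exact mul_le_mul_of_nonneg_left (hf _ (hE.orbitPt_mem_stdSimplex _ _)) hp
  rw [orbitMeasure, integral_sum_dirac fun _ => ENNReal.ofReal_ne_top]
  simp_rw [fun p : Fin n × ℕ => ENNReal.toReal_ofReal (mul_nonneg (hE.c_nonneg p.1 p.2) (hΦ p.1)),
    smul_eq_mul]
  rw [hsum.tsum_prod, tsum_fintype]
  refine Finset.sum_congr rfl fun j _ => ?_
  rw [← tsum_mul_right]
  exact tsum_congr fun m => by ring

/-- One step of the filter from `Γ_0^m e_j` continues the excursion or starts a new one, so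
the excursion sums of `T_μ f` and of `f` differ only in the starting points. -/
lemma tsum_c_mul_markovOp (hE : IsErasureChain E ε) {f : (Fin (n + 1) → ℝ) → ℝ} {C : ℝ}
    (hf : ∀ w ∈ stdSimplex ℝ (Fin (n + 1)), |f w| ≤ C) (j : Fin n) :
    ∑' m, c E ε j m * markovOp E ε f (orbitPt E ε j m) =
      ∑' m, c E ε j m * f (orbitPt E ε j m) - f (E j.succ) +
        ∑ k, f (E k.succ) * returnMatrix E ε k j := by
  have h : ∀ m, c E ε j m * markovOp E ε f (orbitPt E ε j m) =
      c E ε j (m + 1) * f (orbitPt E ε j (m + 1)) +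
        ∑ k : Fin n, f (E k.succ) * (weight E ε k.succ (orbitPt E ε j m) * c E ε j m) := by
    intro m
    rw [hE.markovOp_eq, mul_add, Finset.mul_sum, c_succ, orbitPt_succ]
    congr 1
    · ring
    · exact Finset.sum_congr rfl fun k _ => by ring
  have hs := fun k : Fin n => (hE.summable_weight_mul_c k.succ j).mul_left (f (E k.succ))
  simp_rw [h]
  rw [Summable.tsum_add ((summable_nat_add_iff 1).2 (hE.summable_c_mul hf j))
    (summable_sum fun k _ => hs k), Summable.tsum_finsetSum fun k _ => hs k,
    (hE.summable_c_mul hf j).tsum_eq_zero_add]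
  simp [returnMatrix, tsum_mul_left]

lemma isInvariantMeasure_orbitMeasure (hE : IsErasureChain E ε) {Φ : Fin n → ℝ}
    (hΦ : A E ε *ᵥ Φ = b n) : IsInvariantMeasure E ε (orbitMeasure E ε Φ) := by
  have h0 := hE.nonneg_of_A_mulVec hΦ
  obtain ⟨h1, h2⟩ := (hE.A_mulVec_eq_iff Φ).1 hΦ
  refine ⟨⟨?_⟩, ?_, fun f hf _ => ?_⟩
  · have := hE.integral_orbitMeasure h0 (f := fun _ => 1) (C := 1) (by simp)
    simp only [integral_const, smul_eq_mul, mul_one, h2] at this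
    exact (ENNReal.toReal_eq_one_iff _).1 this
  · have hm := (isClosed_stdSimplex ℝ (Fin (n + 1))).measurableSet.compl
    rw [orbitMeasure, Measure.sum_apply _ hm]
    simp [Measure.dirac_apply' _ hm, hE.orbitPt_mem_stdSimplex]
  · have hf' := hf.mono Set.subset_union_left
    obtain ⟨C, hC⟩ := (isCompact_stdSimplex ℝ (Fin (n + 1))).exists_bound_of_continuousOn hf'
    obtain ⟨D, hD⟩ := (isCompact_stdSimplex ℝ (Fin (n + 1))).exists_bound_of_continuousOn
      (hE.continuousOn_markovOp hf')
    rw [hE.integral_orbitMeasure h0 hC, hE.integral_orbitMeasure h0 hD]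
    simp_rw [hE.tsum_c_mul_markovOp hC, add_mul, sub_mul, Finset.sum_add_distrib,
      Finset.sum_sub_distrib, Finset.sum_mul]
    have : ∑ j, ∑ k, f (E (Fin.succ k)) * returnMatrix E ε k j * Φ j =
        ∑ k : Fin n, f (E k.succ) * Φ k := by
      rw [Finset.sum_comm]
      refine Finset.sum_congr rfl fun k _ => ?_
      simp_rw [mul_assoc, ← Finset.mul_sum]
      congr 1
      exact congrFun h1 k
    rw [this]
    ring

lemma orbitMeasure_real_singleton (hE : IsErasureChain E ε) {Φ : Fin n → ℝ} (hΦ : ∀ j, 0 ≤ Φ j)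
    {j : Fin n} (hj : ∀ i m, orbitPt E ε i m = E j.succ → i = j ∧ m = 0) :
    (orbitMeasure E ε Φ).real {E j.succ} = Φ j := by
  have h1 : ∀ i m, (i = j → m ≠ 0) →
      ({E j.succ} : Set (Fin (n + 1) → ℝ)).indicator (1 : (Fin (n + 1) → ℝ) → ℝ)
        (orbitPt E ε i m) = 0 := by
    intro i m h
    refine Set.indicator_of_notMem (fun h' => ?_) _
    exact h (hj i m h').1 (hj i m h').2
  rw [← integral_indicator_one (measurableSet_singleton _),
    hE.integral_orbitMeasure hΦ (C := 1) fun w _ => ?_, Finset.sum_eq_single j]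
  · rw [tsum_eq_single 0 fun m hm => by rw [h1 j m fun _ => hm, mul_zero], orbitPt_zero, c_zero,
      Set.indicator_of_mem (Set.mem_singleton _), Pi.one_apply, one_mul, one_mul]
  · intro i _ hi
    have h2 := fun m => h1 i m fun h => absurd h hi
    simp_rw [h2, mul_zero, tsum_zero, zero_mul]
  · exact fun h => absurd (Finset.mem_univ j) h
  · by_cases hw : w ∈ ({E j.succ} : Set (Fin (n + 1) → ℝ))
    · rw [Set.indicator_of_mem hw]; simp
    · rw [Set.indicator_of_notMem hw]; simp

end IsErasureChain

/-! ### Block probabilities and the entropy rate -/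

lemma sum_fin_succ_fun {α : Type*} [Fintype α] {N : ℕ} (f : (Fin (N + 1) → α) → ℝ) :
    ∑ y, f y = ∑ a, ∑ y : Fin N → α, f (Fin.cons a y) := by
  rw [← (Fin.consEquiv fun _ => α).sum_comp f, Fintype.sum_prod_type]
  rfl

/-- The probability of observing the word `y` when the hidden state of the first symbol has the
distribution `w`: the product of the weights along the orbit of the filter. -/
noncomputable def blockProb (E : Matrix (Fin (n + 1)) (Fin (n + 1)) ℝ) (ε : Fin (n + 1) → ℝ) :
    ∀ N : ℕ, (Fin N → Fin (n + 1)) → (Fin (n + 1) → ℝ) → ℝ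
  | 0, _, _ => 1
  | N + 1, y, w =>
    weight E ε (y 0) w * blockProb E ε N (fun i => y i.succ) (Gam E ε (y 0) w)

/-- The entropy in bits of the distribution `blockProb E ε N · w`. -/
noncomputable def stateEntropy (E : Matrix (Fin (n + 1)) (Fin (n + 1)) ℝ) (ε : Fin (n + 1) → ℝ)
    (N : ℕ) (w : Fin (n + 1) → ℝ) : ℝ :=
  -∑ y : Fin N → Fin (n + 1), blockProb E ε N y w * Real.logb 2 (blockProb E ε N y w)

lemma blockProb_cons (N : ℕ) (a : Fin (n + 1)) (y : Fin N → Fin (n + 1)) (w : Fin (n + 1) → ℝ) :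
    blockProb E ε (N + 1) (Fin.cons a y) w = weight E ε a w * blockProb E ε N y (Gam E ε a w) := by
  simp [blockProb]

lemma mul_mul_logb_mul (p q : ℝ) :
    p * q * Real.logb 2 (p * q) = p * Real.logb 2 p * q + p * (q * Real.logb 2 q) := by
  by_cases hp : p = 0
  · simp [hp]
  by_cases hq : q = 0
  · simp [hq]
  rw [Real.logb_mul hp hq]
  ring

lemma markovOp_sum {ι : Type*} (s : Finset ι) (f : ι → (Fin (n + 1) → ℝ) → ℝ)
    (w : Fin (n + 1) → ℝ) :
    markovOp E ε (fun x => ∑ k ∈ s, f k x) w = ∑ k ∈ s, markovOp E ε (f k) w := by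
  simp only [markovOp, Finset.mul_sum]
  exact Finset.sum_comm

lemma continuous_h (a : Fin (n + 1)) : Continuous (h E ε a) := by
  have : h E ε a = fun w =>
      -(weight E ε a w * Real.log (weight E ε a w) / Real.log 2) := by
    ext w
    rw [h, Real.logb, mul_div_assoc]
  rw [this]
  exact ((Real.continuous_mul_log.comp (continuous_weight a)).div_const _).neg

namespace IsErasureChain

lemma sum_blockProb (hE : IsErasureChain E ε) (N : ℕ) {w : Fin (n + 1) → ℝ}
    (hw : w ∈ stdSimplex ℝ (Fin (n + 1))) : ∑ y, blockProb E ε N y w = 1 := by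
  induction N generalizing w with
  | zero => simp [blockProb]
  | succ N ih =>
    rw [sum_fin_succ_fun, ← hE.sum_weight hw]
    refine Finset.sum_congr rfl fun a _ => ?_
    simp_rw [blockProb_cons, ← Finset.mul_sum]
    by_cases h : weight E ε a w = 0
    · simp [h]
    · rw [ih (hE.gam_mem (convex_stdSimplex ℝ _) hE.row_mem hw h), mul_one]

/-- The chain rule for entropy, split off at the first symbol. -/
lemma stateEntropy_succ (hE : IsErasureChain E ε) (N : ℕ) {w : Fin (n + 1) → ℝ}
    (hw : w ∈ stdSimplex ℝ (Fin (n + 1))) :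
    stateEntropy E ε (N + 1) w = ∑ a, h E ε a w + markovOp E ε (stateEntropy E ε N) w := by
  rw [stateEntropy, sum_fin_succ_fun, markovOp, ← Finset.sum_add_distrib, ← Finset.sum_neg_distrib]
  refine Finset.sum_congr rfl fun a _ => ?_
  simp_rw [blockProb_cons, mul_mul_logb_mul, Finset.sum_add_distrib, ← Finset.mul_sum]
  rw [stateEntropy, h]
  by_cases h0 : weight E ε a w = 0
  · simp [h0]
  · rw [hE.sum_blockProb N (hE.gam_mem (convex_stdSimplex ℝ _) hE.row_mem hw h0)]
    ring

lemma stateEntropy_eq_sum (hE : IsErasureChain E ε) (N : ℕ) {w : Fin (n + 1) → ℝ}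
    (hw : w ∈ stdSimplex ℝ (Fin (n + 1))) :
    stateEntropy E ε N w =
      ∑ k ∈ Finset.range N, (markovOp E ε)^[k] (fun x => ∑ a, h E ε a x) w := by
  induction N generalizing w with
  | zero => simp [stateEntropy, blockProb]
  | succ N ih =>
    rw [hE.stateEntropy_succ N hw, hE.markovOp_congr (fun w hw => ih hw) hw, markovOp_sum,
      Finset.sum_range_succ', add_comm]
    simp_rw [Function.iterate_succ_apply']
    rfl

lemma sum_mul_noise_mul (hE : IsErasureChain E ε) (a j : Fin (n + 1)) {w : Fin (n + 1) → ℝ}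
    (hw : w ∈ stdSimplex ℝ (Fin (n + 1))) :
    ∑ i, w i * noise ε a i * E i j = weight E ε a w * Gam E ε a w j := by
  by_cases h : weight E ε a w = 0
  · rw [h, zero_mul]
    rw [hE.weight_eq, Finset.sum_eq_zero_iff_of_nonneg fun i _ =>
      mul_nonneg (hw.1 i) (hE.noise_nonneg a i)] at h
    exact Finset.sum_eq_zero fun i hi => by rw [h i hi, zero_mul]
  · rw [gam_eq_sum h, Finset.sum_apply, Finset.mul_sum]
    refine Finset.sum_congr rfl fun i _ => ?_
    rw [Pi.smul_apply, smul_eq_mul]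
    field_simp

/-- The probability of an observed word is the sum over all hidden paths `x` of the joint
probabilities. -/
lemma sum_path_eq_blockProb (hE : IsErasureChain E ε) (N : ℕ) (y : Fin (N + 1) → Fin (n + 1))
    {w : Fin (n + 1) → ℝ} (hw : w ∈ stdSimplex ℝ (Fin (n + 1))) :
    ∑ x : Fin (N + 1) → Fin (n + 1), w (x 0) * (∏ i : Fin N, E (x i.castSucc) (x i.succ)) *
      ∏ i : Fin (N + 1), noise ε (y i) (x i) = blockProb E ε (N + 1) y w := by
  induction N generalizing w with
  | zero =>
    rw [sum_fin_succ_fun]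
    simp [blockProb, hE.weight_eq]
  | succ N ih =>
    rw [sum_fin_succ_fun, Finset.sum_comm]
    have h1 : ∀ x : Fin (N + 1) → Fin (n + 1), ∑ a, w ((Fin.cons a x : Fin (N + 2) → _) 0) *
        (∏ i : Fin (N + 1), E ((Fin.cons a x : Fin (N + 2) → _) i.castSucc)
          ((Fin.cons a x : Fin (N + 2) → _) i.succ)) *
        ∏ i : Fin (N + 2), noise ε (y i) ((Fin.cons a x : Fin (N + 2) → _) i) =
        weight E ε (y 0) w * (Gam E ε (y 0) w (x 0) *
          (∏ i : Fin N, E (x i.castSucc) (x i.succ)) *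
          ∏ i : Fin (N + 1), noise ε (y i.succ) (x i)) := by
      intro x
      rw [← mul_assoc, ← mul_assoc, ← hE.sum_mul_noise_mul _ _ hw, Finset.sum_mul, Finset.sum_mul]
      refine Finset.sum_congr rfl fun a _ => ?_
      rw [Fin.prod_univ_succ, Fin.prod_univ_succ (n := N + 1)]
      simp only [Fin.cons_zero, Fin.cons_succ, Fin.castSucc_zero, ← Fin.succ_castSucc]
      ring
    simp_rw [h1, ← Finset.mul_sum]
    rw [blockProb]
    by_cases h : weight E ε (y 0) w = 0
    · simp [h]
    · rw [ih (fun i => y i.succ) (hE.gam_mem (convex_stdSimplex ℝ _) hE.row_mem hw h)]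

lemma processLaw_real_cylinder (hE : IsErasureChain E ε) {τ : Fin (n + 1) → ℝ}
    (hτ : τ ∈ stdSimplex ℝ (Fin (n + 1)))
    {Ω : Type*} [MeasurableSpace Ω] {P : Measure Ω} [IsProbabilityMeasure P]
    {X Y : ℤ → Ω → Fin (n + 1)} (hXY : IsHiddenMarkovProcess P E (noise ε) τ X Y)
    (N : ℕ) (y : Fin (N + 1) → Fin (n + 1)) :
    (processLaw P Y).real {ω | ∀ i : Fin (N + 1), ω ((i : ℕ) + 1) = y i} =
      blockProb E ε (N + 1) y τ := by
  have hY : Measurable fun ω i => Y i ω := measurable_pi_lambda _ hXY.measurable_obs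
  have hs : MeasurableSet {ω : ℤ → Fin (n + 1) | ∀ i : Fin (N + 1), ω ((i : ℕ) + 1) = y i} := by
    rw [Set.ofPred_forall]
    exact MeasurableSet.iInter fun i =>
      measurableSet_eq_fun (measurable_pi_apply _) measurable_const
  rw [processLaw, map_measureReal_apply hY hs, ← hE.sum_path_eq_blockProb N y hτ]
  have hunion : (fun ω i => Y i ω) ⁻¹'
      {ω : ℤ → Fin (n + 1) | ∀ i : Fin (N + 1), ω ((i : ℕ) + 1) = y i} =
      ⋃ x ∈ (Finset.univ : Finset (Fin (N + 1) → Fin (n + 1))),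
        {ω | ∀ i : Fin (N + 1), X (1 + (i : ℕ)) ω = x i ∧ Y (1 + (i : ℕ)) ω = y i} := by
    ext ω
    simp only [Set.mem_preimage, Set.mem_ofPred_eq, Finset.mem_univ, Set.iUnion_true,
      Set.mem_iUnion, add_comm (1 : ℤ)]
    exact ⟨fun h => ⟨fun i => X ((i : ℕ) + 1) ω, fun i => ⟨rfl, h i⟩⟩,
      fun ⟨x, hx⟩ i => (hx i).2⟩
  rw [hunion, measureReal_biUnion_finset]
  · exact Finset.sum_congr rfl fun x _ => hXY.joint_law 1 N x y
  · intro x _ x' _ hne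
    refine Set.disjoint_left.2 fun ω h h' => hne (funext fun i => ?_)
    rw [← (h i).1, (h' i).1]
  · intro x _
    rw [Set.ofPred_forall]
    exact MeasurableSet.iInter fun i =>
      (hXY.measurable_source _ (measurableSet_singleton (x i))).inter
        (hXY.measurable_obs _ (measurableSet_singleton (y i)))

lemma hasEntropyRate (hE : IsErasureChain E ε) (hn : 0 < n) {τ : Fin (n + 1) → ℝ}
    (hτ : τ ∈ stdSimplex ℝ (Fin (n + 1)))
    {Ω : Type*} [MeasurableSpace Ω] {P : Measure Ω} [IsProbabilityMeasure P]
    {X Y : ℤ → Ω → Fin (n + 1)} (hXY : IsHiddenMarkovProcess P E (noise ε) τ X Y)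
    {φ : Measure (Fin (n + 1) → ℝ)} (hφ : IsInvariantMeasure E ε φ) :
    HasEntropyRate (processLaw P Y) (∫ w, ∑ a, h E ε a w ∂φ) := by
  have hlim := hE.tendsto_iterate hn hφ (f := fun x => ∑ a, h E ε a x)
    (continuous_finsetSum _ fun a _ => continuous_h a).continuousOn
    (by simp [h, weight_zero_vec]) hτ
  refine hlim.cesaro.congr' ?_
  filter_upwards [eventually_ge_atTop 1] with N hN
  obtain ⟨N, rfl⟩ := Nat.exists_eq_add_of_le' hN
  rw [← hE.stateEntropy_eq_sum (N + 1) hτ, stateEntropy, blockEntropy, div_eq_inv_mul]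
  simp_rw [hE.processLaw_real_cylinder hτ hXY]

end IsErasureChain

end HiddenMarkov

theorem mainTheorem1 (n : ℕ) (E : Matrix (Fin (n + 1)) (Fin (n + 1)) ℝ)
    (ε τ : Fin (n + 1) → ℝ)
    (hE_sum : ∀ i, ∑ j, E i j = 1)
    (hE_pos : ∀ i j, 0 < E i j) (hE_lt : ∀ i j, E i j < 1)
    (hε_zero : ε 0 = 1) (hε : ∀ a, a ≠ 0 → 0 < ε a ∧ ε a < 1)
    (hτ : HiddenMarkov.IsStationary E τ)
    {Ω : Type*} [MeasurableSpace Ω] (P : Measure Ω) [IsProbabilityMeasure P]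
    (X Y : ℤ → Ω → Fin (n + 1))
    (hXY : HiddenMarkov.IsHiddenMarkovProcess P E (HiddenMarkov.noise ε) τ X Y) :
    -- all the series that occur converge
    (∀ j : Fin n, Summable (HiddenMarkov.c E ε j)) ∧
    (∀ i j : Fin n, Summable fun m : ℕ =>
      HiddenMarkov.weight E ε i.succ (HiddenMarkov.orbitPt E ε j m) * HiddenMarkov.c E ε j m) ∧
    (∀ j : Fin n, Summable fun m : ℕ =>
      ∑ a, HiddenMarkov.h E ε a (HiddenMarkov.orbitPt E ε j m) * HiddenMarkov.c E ε j m) ∧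
    -- the linear system has exactly one solution, and it gives the entropy rate
    (∃! Φ : Fin n → ℝ, HiddenMarkov.A E ε *ᵥ Φ = HiddenMarkov.b n) ∧
    (∀ Φ : Fin n → ℝ, HiddenMarkov.A E ε *ᵥ Φ = HiddenMarkov.b n →
      HiddenMarkov.HasEntropyRate (HiddenMarkov.processLaw P Y)
        (∑ j : Fin n, ∑' m : ℕ, ∑ a,
          HiddenMarkov.h E ε a (HiddenMarkov.orbitPt E ε j m) * HiddenMarkov.c E ε j m * Φ j)) ∧
    -- the invariant measure is unique, and the solution of the linear system consists of its
    -- masses at the rows `e_1, ..., e_{q-1}`, as long as these are not hit by other orbit points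
    (∃! φ : Measure (Fin (n + 1) → ℝ), HiddenMarkov.IsInvariantMeasure E ε φ) ∧
    (∀ φ : Measure (Fin (n + 1) → ℝ), HiddenMarkov.IsInvariantMeasure E ε φ →
      ∀ Φ : Fin n → ℝ, HiddenMarkov.A E ε *ᵥ Φ = HiddenMarkov.b n →
        ∀ j : Fin n,
          (∀ (i : Fin n) (m : ℕ), HiddenMarkov.orbitPt E ε i m = E j.succ → i = j ∧ m = 0) →
            Φ j = φ.real {E j.succ}) := by
  have hE : HiddenMarkov.IsErasureChain E ε := ⟨hE_sum, hE_pos, hε_zero, hε⟩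
  -- a stochastic `1 × 1` matrix has the entry `1`
  have hn : 0 < n := by
    rcases Nat.eq_zero_or_pos n with rfl | hn
    · exact absurd (by simpa using hE_sum 0) (hE_lt 0 0).ne
    · exact hn
  have hcont : ContinuousOn (fun w => ∑ a, HiddenMarkov.h E ε a w)
      (stdSimplex ℝ (Fin (n + 1))) :=
    (continuous_finsetSum _ fun a _ => HiddenMarkov.continuous_h a).continuousOn
  obtain ⟨C, hC⟩ := (isCompact_stdSimplex ℝ (Fin (n + 1))).exists_bound_of_continuousOn hcont
  have hΦ := hE.existsUnique_A_mulVec hn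
  refine ⟨hE.summable_c, fun i j => hE.summable_weight_mul_c i.succ j, fun j => ?_, hΦ,
    fun Φ h => ?_, ?_, fun φ hφ Φ h j hj => ?_⟩
  · simp_rw [← Finset.sum_mul, mul_comm _ (HiddenMarkov.c E ε j _)]
    exact hE.summable_c_mul hC j
  · have := hE.hasEntropyRate hn hτ.1 hXY (hE.isInvariantMeasure_orbitMeasure h)
    rw [hE.integral_orbitMeasure (hE.nonneg_of_A_mulVec h) hC] at this
    convert this using 3 with j
    simp_rw [← Finset.sum_mul, tsum_mul_right, mul_comm _ (HiddenMarkov.c E ε j _)]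
  · obtain ⟨Φ, h, -⟩ := hΦ
    exact ⟨_, hE.isInvariantMeasure_orbitMeasure h, fun ψ hψ =>
      hE.invariantMeasure_unique hn hψ (hE.isInvariantMeasure_orbitMeasure h)⟩
  · rw [hE.invariantMeasure_unique hn hφ (hE.isInvariantMeasure_orbitMeasure h),
      hE.orbitMeasure_real_singleton (hE.nonneg_of_A_mulVec h) hj]
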